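/- **Setting.** For a category $\mathcal V$, a *$\mathcal V$-graph* $A$ is a set $A_0$ of objects with an object $A(a,a')\in\mathcal V$ for all $a,a'\in A_0$. For an operad $P$ (non-symmetric) in a category $\mathcal V$ with finite products, a *$(\mathcal V,P)$-category* is a $\mathcal V$-graph $A$ with morphisms $P(k)\times A(a_{k-1},a_k)\times\cdots\times A(a_0,a_1)\to A(a_0,a_k)$ for all $k\ge 0$ and $a_0,\dots,a_k\in A_0$, compatible with the unit and the composition of $P$; morphisms are the morphisms of $\mathcal V$-graphs that commute with these. Let $P_0,P_1,\dots$ be operads, $P_i$ in $\mathcal V_i$, where $\mathcal V_0=\mathbf{Set}$ and $\mathcal V_{i+1}$ is the category of $(\mathcal V_i,P_i)$-categories. No contractibility of the $P_i$ is assumed. **Contractible operads.** An object of $\mathcal V_0=\mathbf{Set}$ is *contractible* if it is a one-element set; an object $A$ of $\mathcal V_{i+1}$ is *contractible* if $A_0\neq\emptyset$ and every $A(a,a')$ is contractible in $\mathcal V_i$. The operad $P_i$ is *contractible* if every $P_i(k)$, $k\ge 0$, is contractible in $\mathcal V_i$. **The globular operad $Q^{(n)}$.** Identify $n$-dimensional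 globular sets with $n$-graphs: a $0$-graph is a set, and an $(n+1)$-graph is a graph enriched in $n$-graphs. Write $U:\mathcal V_n\to n\text{-}\mathbf{Gph}$ for the forgetful functor, and $F_*$ for the functor on graphs that is the identity on objects and $F$ on hom-objects. The free strict $n$-category monad $T^{(n)}$ and the free $n$-category monad $Q^{(n)}$ on $n$-graphs have underlying functors $T^{(0)}=Q^{(0)}=\mathrm{id}$ and $T^{(n+1)}=\mathrm{fc}\circ T^{(n)}_*$, $Q^{(n+1)}=\mathrm{fc}_{UP_n}\circ Q^{(n)}_*$, where $\mathrm{fc}$ and $\mathrm{fc}_{UP_n}$ are the identity on objects and $$(\mathrm{fc}\,A)(a,a')=\coprod_{k\ge 0,\ a=a_0,\dots,a_k=a'}A(a_{k-1},a_k)\times\cdots\times A(a_0,a_1),$$ $$(\mathrm{fc}_{UP_n}A)(a,a')=\coprod_{k\ge 0,\ a=a_0,\dots,a_k=a'}UP_n(k)\times A(a_{k-1},a_k)\times\cdots\times A(a_0,a_1).$$ Forgetting the factors $UP_i(k)$ gives a natural transformation $Q^{(n)}\Rightarrow T^{(n)}$, which makes $Q^{(n)}$ a globular operad with underlying collection $p: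 Q^{(n)}1\to T^{(n)}1$, its component at the terminal $n$-graph $1$. **Contractible globular operads.** Call two $m$-cells parallel if $m=0$ or they have the same source and the same target. A globular operad with underlying collection $p:A\to T^{(n)}1$ is *contractible* if (i) for all $0\le m<n$, all parallel $m$-cells $a,b$ of $A$ and every $(m+1)$-cell $y:pa\to pb$ of $T^{(n)}1$ there is an $(m+1)$-cell $x:a\to b$ of $A$ with $px=y$; and (ii) parallel $n$-cells $a,b$ of $A$ with $pa=pb$ are equal. **Proposition.** For every $n\ge 0$, the globular operad $Q^{(n)}$ is contractible if and only if for all $0\le i<n$ the operad $P_i$ is contractible. -/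

import Mathlib

open CategoryTheory CategoryTheory.Limits

universe u

namespace IterOp

/-! ### Graphs enriched in a category -/

/-- A `V`-graph: a set of objects, and a hom-object of `V` for every pair of objects. -/
structure VGraph (V : Type (u + 1)) [Category.{u} V] : Type (u + 1) where
  obj : Type u
  hom : obj → obj → V

namespace VGraph

section
variable {V W : Type (u + 1)} [Category.{u} V] [Category.{u} W]

structure Hom (A B : VGraph V) : Type u where
  obj : A.obj → B.obj
  hom : ∀ a a', A.hom a a' ⟶ B.hom (obj a) (obj a')

instance : Category.{u} (VGraph V) where
  Hom := Hom
  id A := ⟨id, fun _ _ => 𝟙 _⟩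
  comp F G := ⟨G.obj ∘ F.obj, fun a a' => F.hom a a' ≫ G.hom _ _⟩
  id_comp F := by cases F; simp
  comp_id F := by cases F; simp
  assoc F G H := by simp [Function.comp_assoc]

@[simp] theorem id_obj (A : VGraph V) : Hom.obj (𝟙 A) = id := rfl
@[simp] theorem id_hom (A : VGraph V) (a a' : A.obj) : Hom.hom (𝟙 A) a a' = 𝟙 _ := rfl
@[simp] theorem comp_obj {A B C : VGraph V} (F : A ⟶ B) (G : B ⟶ C) :
    Hom.obj (F ≫ G) = Hom.obj G ∘ Hom.obj F := rfl
@[simp] theorem comp_hom {A B C : VGraph V} (F : A ⟶ B) (G : B ⟶ C) (a a' : A.obj) :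
    Hom.hom (F ≫ G) a a' = Hom.hom F a a' ≫ Hom.hom G _ _ := rfl

/-- The identification of hom-objects whose end points are equal. -/
def cast (A : VGraph V) {a b a' b' : A.obj} (h : a = a') (h' : b = b') :
    A.hom a b ⟶ A.hom a' b' := eqToHom (by rw [h, h'])

@[simp] theorem cast_rfl (A : VGraph V) (a b : A.obj) :
    A.cast (rfl : a = a) (rfl : b = b) = 𝟙 _ := rfl

theorem cast_hom {A B : VGraph V} (F : Hom A B) {a b a' b' : A.obj} (h : a = a') (h' : b = b') :
    A.cast h h' ≫ F.hom a' b' =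
      F.hom a b ≫ B.cast (congrArg F.obj h) (congrArg F.obj h') := by
  subst h h'; simp

theorem hom_ext {A B : VGraph V} {F G : A ⟶ B} (h : ∀ a, Hom.obj F a = Hom.obj G a)
    (h' : ∀ a a', Hom.hom F a a' ≫ B.cast (h a) (h a') = Hom.hom G a a') : F = G := by
  obtain ⟨f, F⟩ := F
  obtain ⟨g, G⟩ := G
  obtain rfl : f = g := funext h
  congr 1
  funext a a'
  simpa using h' a a'

theorem mk_eq {A B : VGraph V} {o : A.obj → B.obj}
    {f g : ∀ a a', A.hom a a' ⟶ B.hom (o a) (o a')} (h : ∀ a a', f a a' = g a a') :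
    (⟨o, f⟩ : Hom A B) = ⟨o, g⟩ := by
  obtain rfl : f = g := funext fun a => funext fun a' => h a a'
  rfl

theorem hom_congr {A B : VGraph V} {F G : A ⟶ B} (e : F = G) (a a' : A.obj) :
    Hom.hom F a a' ≫ B.cast (congrFun (congrArg Hom.obj e) a) (congrFun (congrArg Hom.obj e) a') =
      Hom.hom G a a' := by
  subst e; simp

/-- The functor `F_*` on graphs induced by `F`: identity on objects, and `F` on hom-objects. -/
def map (F : V ⥤ W) : VGraph V ⥤ VGraph W where
  obj A := ⟨A.obj, fun a a' => F.obj (A.hom a a')⟩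
  map f := ⟨(show Hom _ _ from f).obj, fun a a' => F.map ((show Hom _ _ from f).hom a a')⟩
  map_id _ := mk_eq fun _ _ => F.map_id _
  map_comp _ _ := mk_eq fun _ _ => F.map_comp _ _

/-- The transformation `F_* ⟶ G_*` induced by `F ⟶ G`. -/
def mapNat {F G : V ⥤ W} (α : F ⟶ G) : map F ⟶ map G where
  app A := ⟨fun a : A.obj => a, fun a a' : A.obj => α.app (A.hom a a')⟩
  naturality A _ f := mk_eq fun a a' : A.obj => α.naturality (Hom.hom f a a')

/-! Coproducts and products of graphs. -/

/-- The coproduct of a family of graphs: the disjoint union of the sets of objects, with initial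
hom-objects between different summands. -/
noncomputable def cofan [HasCoproducts.{u} V] {J : Type u} (A : J → VGraph V) : Cofan A :=
  Cofan.mk
    (⟨Σ j, (A j).obj, fun x y => ∐ fun h : ULift.{u} (PLift (x.1 = y.1)) =>
      (A y.1).hom (h.down.down ▸ x.2) y.2⟩ : VGraph V)
    fun j => ⟨fun a => ⟨j, a⟩, fun a a' =>
      Sigma.ι (fun h : ULift.{u} (PLift (j = j)) => (A j).hom (h.down.down ▸ a) a') ⟨⟨rfl⟩⟩⟩

noncomputable def cofanDesc [HasCoproducts.{u} V] {J : Type u} {A : J → VGraph V} (t : Cofan A) :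
    (cofan A).pt ⟶ t.pt :=
  ⟨fun x => Hom.obj (t.inj x.1) x.2, fun x y => Sigma.desc fun h =>
    match x, y, h with
    | ⟨_, a⟩, ⟨_, a'⟩, ⟨⟨rfl⟩⟩ => Hom.hom (t.inj _) a a'⟩

theorem cofan_isColimit [HasCoproducts.{u} V] {J : Type u} (A : J → VGraph V) :
    Nonempty (IsColimit (cofan A)) := by
  refine ⟨Cofan.IsColimit.mk _ (fun t => cofanDesc t) (fun t j => ?_) fun t m hm => ?_⟩
  · exact mk_eq fun a a' => Sigma.ι_desc _ _
  · have key : ∀ j, (cofan A).inj j ≫ m = t.inj j := hm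
    refine hom_ext (fun x => ?_) ?_
    · exact congrFun (congrArg Hom.obj (key x.1)) x.2
    · rintro ⟨j, a⟩ ⟨j', a'⟩
      refine Sigma.hom_ext _ _ ?_
      rintro ⟨⟨h⟩⟩
      obtain rfl : j = j' := h
      refine (Category.assoc _ _ _).symm.trans ((hom_congr (key j) a a').trans ?_)
      symm
      exact Sigma.ι_desc _ _

instance [HasCoproducts.{u} V] : HasCoproducts.{u} (VGraph V) :=
  hasCoproducts_of_colimit_cofans (fun A => cofan A) fun A => (cofan_isColimit A).some

/-- The product of a finite family of graphs. -/
noncomputable def fan [HasFiniteProducts V] {J : Type} [Finite J] (A : J → VGraph V) : Fan A :=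
  Fan.mk (⟨∀ j, (A j).obj, fun x y => ∏ᶜ fun j => (A j).hom (x j) (y j)⟩ : VGraph V)
    fun j => ⟨fun x => x j, fun x y => Pi.π (fun j => (A j).hom (x j) (y j)) j⟩

noncomputable def fanLift [HasFiniteProducts V] {J : Type} [Finite J] {A : J → VGraph V}
    (t : Fan A) : t.pt ⟶ (fan A).pt :=
  ⟨fun x j => Hom.obj (t.proj j) x, fun x y => Pi.lift fun j => Hom.hom (t.proj j) x y⟩

theorem fan_hom_unique [HasFiniteProducts V] {J : Type} [Finite J] {A : J → VGraph V} {X : VGraph V}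
    {F : X ⟶ (fan A).pt} (t : Fan A) (f : X ⟶ t.pt)
    (h : ∀ j, F ≫ (fan A).proj j = f ≫ t.proj j) : F = f ≫ fanLift t := by
  have h0 : ∀ j x, Hom.obj F x j = Hom.obj (t.proj j) (Hom.obj f x) := fun j x =>
    congrFun (congrArg Hom.obj (h j)) x
  refine hom_ext (fun x => funext fun j => h0 j x) fun x y => ?_
  refine Pi.hom_ext _ _ fun j => ?_
  refine (Category.assoc _ _ _).trans ?_
  refine Eq.trans (congrArg _ (cast_hom ((fan A).proj j) _ _)) ?_
  refine (Category.assoc _ _ _).symm.trans ((hom_congr (h j) x y).trans ?_)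
  refine Eq.trans ?_ (Category.assoc _ _ _).symm
  refine congrArg _ ?_
  symm
  exact Pi.lift_π _ _

theorem fan_isLimit [HasFiniteProducts V] {J : Type} [Finite J] (A : J → VGraph V) :
    Nonempty (IsLimit (fan A)) := by
  refine ⟨Fan.IsLimit.mk _ (fun t => fanLift t) (fun t j => ?_) fun t m hm => ?_⟩
  · exact mk_eq fun a a' => Pi.lift_π _ _
  · refine (fan_hom_unique t (𝟙 _) fun j => ?_).trans (Category.id_comp _)
    rw [Category.id_comp]
    exact hm j

end

end VGraph

theorem hasFiniteProducts_of_fans {C : Type (u + 1)} [Category.{u} C]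
    (h : ∀ {n : ℕ} (A : Fin n → C), HasProduct A) : HasFiniteProducts C :=
  ⟨fun _ => ⟨fun K => hasLimit_of_iso (F := Discrete.functor fun i => K.obj ⟨i⟩)
    (Discrete.natIsoFunctor (F := K)).symm⟩⟩

instance {V : Type (u + 1)} [Category.{u} V] [HasFiniteProducts V] :
    HasFiniteProducts (VGraph V) :=
  hasFiniteProducts_of_fans fun A => ⟨⟨_, (VGraph.fan_isLimit A).some⟩⟩

/-! ### Free `V`-categories and free `(V, P)`-categories on a graph -/

namespace VGraph

/-- A string of objects `a = a₀, a₁, …, aₖ = a'` of a graph, with `k ≥ 0`. -/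
structure ObjPath {V : Type (u + 1)} [Category.{u} V] (A : VGraph V) (a a' : A.obj) : Type u where
  len : ℕ
  pt : Fin (len + 1) → A.obj
  source : pt 0 = a
  target : pt (Fin.last len) = a'

section
variable {V : Type (u + 1)} [Category.{u} V]

def ObjPath.map {A B : VGraph V} (F : A ⟶ B) {a a' : A.obj} (σ : A.ObjPath a a') :
    B.ObjPath (Hom.obj F a) (Hom.obj F a') :=
  ⟨σ.len, fun i => Hom.obj F (σ.pt i), congrArg _ σ.source, congrArg _ σ.target⟩

variable [HasFiniteProducts V]

/-- The product `A(a₀, a₁) × ⋯ × A(aₖ₋₁, aₖ)` along a string of objects. -/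
noncomputable abbrev string (A : VGraph V) {k : ℕ} (a : Fin (k + 1) → A.obj) : V :=
  ∏ᶜ fun i : Fin k => A.hom (a i.castSucc) (a i.succ)

noncomputable abbrev stringMap {A B : VGraph V} (F : A ⟶ B) {k : ℕ} (a : Fin (k + 1) → A.obj) :
    A.string a ⟶ B.string (fun i => Hom.obj F (a i)) :=
  Limits.Pi.map fun i => Hom.hom F (a i.castSucc) (a i.succ)

theorem stringMap_id (A : VGraph V) {k : ℕ} (a : Fin (k + 1) → A.obj) :
    stringMap (𝟙 A) a = 𝟙 (A.string a) := by
  refine Pi.hom_ext _ _ fun i => (Limits.Pi.map_π _ _).trans ?_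
  exact (Category.comp_id _).trans (Category.id_comp _).symm

theorem stringMap_comp {A B C : VGraph V} (F : A ⟶ B) (G : B ⟶ C) {k : ℕ}
    (a : Fin (k + 1) → A.obj) :
    stringMap (F ≫ G) a = stringMap F a ≫ stringMap G fun i => Hom.obj F (a i) := by
  refine Pi.hom_ext _ _ fun i => ?_
  symm
  refine (Category.assoc _ _ _).trans ?_
  refine (congrArg _ (Limits.Pi.map_π _ _)).trans ?_
  refine (Category.assoc _ _ _).symm.trans ?_
  refine (congrArg (· ≫ _) (Limits.Pi.map_π _ _)).trans ?_
  refine (Category.assoc _ _ _).trans ?_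
  symm
  exact Limits.Pi.map_π _ _

variable [HasCoproducts.{u} V]

/-- The coproduct of `A(a₀, a₁) × ⋯ × A(aₖ₋₁, aₖ)` over all `k ≥ 0` and `a = a₀, …, aₖ = a'`. -/
noncomputable abbrev fcObj (A : VGraph V) (a a' : A.obj) : V :=
  ∐ fun σ : A.ObjPath a a' => A.string σ.pt

noncomputable def fcMap {A B : VGraph V} (F : A ⟶ B) (a a' : A.obj) :
    A.fcObj a a' ⟶ B.fcObj (Hom.obj F a) (Hom.obj F a') :=
  Sigma.desc fun σ => stringMap F σ.pt ≫
    Sigma.ι (fun τ : B.ObjPath (Hom.obj F a) (Hom.obj F a') => B.string τ.pt) (σ.map F)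

theorem ι_fcMap {A B : VGraph V} (F : A ⟶ B) (a a' : A.obj) (σ : A.ObjPath a a') :
    Sigma.ι (fun σ : A.ObjPath a a' => A.string σ.pt) σ ≫ fcMap F a a' =
      stringMap F σ.pt ≫
        Sigma.ι (fun τ : B.ObjPath (Hom.obj F a) (Hom.obj F a') => B.string τ.pt) (σ.map F) :=
  Sigma.ι_desc _ _

/-- The underlying functor of the free `V`-category monad on `V`-graphs: identity on objects, and
`(fc A)(a, a') = ∐ A(a₀, a₁) × ⋯ × A(aₖ₋₁, aₖ)` on hom-objects. -/
noncomputable def fc : VGraph V ⥤ VGraph V where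
  obj A := ⟨A.obj, A.fcObj⟩
  map F := ⟨(show Hom _ _ from F).obj, fcMap F⟩
  map_id A := mk_eq fun a a' : A.obj => by
    refine Sigma.hom_ext _ _ fun σ => (ι_fcMap _ _ _ _).trans ?_
    refine (congrArg (· ≫ _) (stringMap_id A σ.pt)).trans ?_
    exact (Category.id_comp _).trans (Category.comp_id _).symm
  map_comp {A B C} F G := mk_eq fun a a' : A.obj => by
    refine Sigma.hom_ext _ _ fun σ => (ι_fcMap _ _ _ _).trans ?_
    have h := ι_fcMap G _ _ (σ.map F)
    refine (congrArg (· ≫ _) (stringMap_comp F G σ.pt)).trans ?_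
    refine (Category.assoc _ _ _).trans ((congrArg _ h.symm).trans ?_)
    refine (Category.assoc _ _ _).symm.trans ?_
    refine (congrArg (· ≫ _) (ι_fcMap F a a' σ).symm).trans ?_
    exact Category.assoc _ _ _

/-- The coproduct of `P(k) × A(a₀, a₁) × ⋯ × A(aₖ₋₁, aₖ)` over all `k ≥ 0` and
`a = a₀, …, aₖ = a'`. -/
noncomputable abbrev fcPObj (P : ℕ → V) (A : VGraph V) (a a' : A.obj) : V :=
  ∐ fun σ : A.ObjPath a a' => P σ.len ⨯ A.string σ.pt

noncomputable def fcPMap (P : ℕ → V) {A B : VGraph V} (F : A ⟶ B) (a a' : A.obj) :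
    A.fcPObj P a a' ⟶ B.fcPObj P (Hom.obj F a) (Hom.obj F a') :=
  Sigma.desc fun σ => prod.map (𝟙 (P σ.len)) (stringMap F σ.pt) ≫
    Sigma.ι (fun τ : B.ObjPath (Hom.obj F a) (Hom.obj F a') => P τ.len ⨯ B.string τ.pt) (σ.map F)

theorem ι_fcPMap (P : ℕ → V) {A B : VGraph V} (F : A ⟶ B) (a a' : A.obj) (σ : A.ObjPath a a') :
    Sigma.ι (fun σ : A.ObjPath a a' => P σ.len ⨯ A.string σ.pt) σ ≫ fcPMap P F a a' =
      prod.map (𝟙 (P σ.len)) (stringMap F σ.pt) ≫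
        Sigma.ι (fun τ : B.ObjPath (Hom.obj F a) (Hom.obj F a') => P τ.len ⨯ B.string τ.pt)
          (σ.map F) :=
  Sigma.ι_desc _ _

/-- The underlying functor of the free `(V, P)`-category monad on `V`-graphs, where the sequence
`P` underlies an operad: identity on objects, and
`(fcP A)(a, a') = ∐ P(k) × A(a₀, a₁) × ⋯ × A(aₖ₋₁, aₖ)` on hom-objects. -/
noncomputable def fcP (P : ℕ → V) : VGraph V ⥤ VGraph V where
  obj A := ⟨A.obj, A.fcPObj P⟩
  map F := ⟨(show Hom _ _ from F).obj, fcPMap P F⟩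
  map_id A := mk_eq fun a a' : A.obj => by
    refine Sigma.hom_ext _ _ fun σ => (ι_fcPMap _ _ _ _ _).trans ?_
    refine (congrArg (fun f => prod.map (𝟙 (P σ.len)) f ≫ _) (stringMap_id A σ.pt)).trans ?_
    refine (congrArg (· ≫ _) (prod.map_id_id (X := P σ.len) (Y := A.string σ.pt))).trans ?_
    exact (Category.id_comp _).trans (Category.comp_id _).symm
  map_comp {A B C} F G := mk_eq fun a a' : A.obj => by
    refine Sigma.hom_ext _ _ fun σ => (ι_fcPMap _ _ _ _ _).trans ?_
    have h := ι_fcPMap P G _ _ (σ.map F)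
    refine (congrArg (fun f => prod.map (𝟙 (P σ.len)) f ≫ _) (stringMap_comp F G σ.pt)).trans ?_
    refine (congrArg (· ≫ _) (prod.map_id_comp (W := P σ.len) _ _)).trans ?_
    refine (Category.assoc _ _ _).trans ((congrArg _ h.symm).trans ?_)
    refine (Category.assoc _ _ _).symm.trans ?_
    refine (congrArg (· ≫ _) (ι_fcPMap P F a a' σ).symm).trans ?_
    exact Category.assoc _ _ _

noncomputable def fcPToFcHom (P : ℕ → V) (A : VGraph V) (a a' : A.obj) :
    A.fcPObj P a a' ⟶ A.fcObj a a' :=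
  Sigma.desc fun σ => prod.snd ≫ Sigma.ι (fun σ : A.ObjPath a a' => A.string σ.pt) σ

theorem ι_fcPToFcHom (P : ℕ → V) (A : VGraph V) (a a' : A.obj) (σ : A.ObjPath a a') :
    Sigma.ι (fun σ : A.ObjPath a a' => P σ.len ⨯ A.string σ.pt) σ ≫ fcPToFcHom P A a a' =
      prod.snd ≫ Sigma.ι (fun σ : A.ObjPath a a' => A.string σ.pt) σ :=
  Sigma.ι_desc _ _

/-- The transformation from free `(V, P)`-categories to free `V`-categories induced by the map from
`P` to the terminal operad: it forgets the factors `P(k)`. -/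
noncomputable def fcPToFc (P : ℕ → V) : fcP P ⟶ fc (V := V) where
  app A := ⟨fun a : A.obj => a, fcPToFcHom P A⟩
  naturality A B F := mk_eq fun a a' : A.obj => by
    have h1 := ι_fcPMap P F a a'
    have h2 := ι_fcMap F a a'
    have h3 := ι_fcPToFcHom P A a a'
    have h4 := ι_fcPToFcHom P B (Hom.obj F a) (Hom.obj F a')
    refine Sigma.hom_ext _ _ fun σ => ?_
    refine (Category.assoc _ _ _).symm.trans ((congrArg (· ≫ _) (h1 σ)).trans ?_)
    refine (Category.assoc _ _ _).trans ((congrArg _ (h4 _)).trans ?_)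
    refine (Category.assoc _ _ _).symm.trans ?_
    refine (congrArg (· ≫ _) (prod.map_snd _ _)).trans ((Category.assoc _ _ _).trans ?_)
    refine (congrArg _ (h2 σ).symm).trans ((Category.assoc _ _ _).symm.trans ?_)
    exact (congrArg (· ≫ fcMap F a a') (h3 σ).symm).trans (Category.assoc _ _ _)

end

end VGraph

/-! ### Operads -/

theorem sum_blocks {m : ℕ} {k : Fin m → ℕ} (l : ∀ i, Fin (k i) → ℕ) :
    ∑ i, ∑ j, l i j =
      ∑ s : Fin (∑ i, k i), l (finSigmaFinEquiv.symm s).1 (finSigmaFinEquiv.symm s).2 := by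
  rw [← (finSigmaFinEquiv (n := k)).sum_comp, ← Finset.univ_sigma_univ, Finset.sum_sigma]
  exact Finset.sum_congr rfl fun i _ => Finset.sum_congr rfl fun j _ => by
    rw [Equiv.symm_apply_apply]

section
variable (V : Type (u + 1)) [Category.{u} V] [HasFiniteProducts V]

/-- The data of a (non-symmetric) operad. -/
structure OperadData where
  obj : ℕ → V
  unit : ⊤_ V ⟶ obj 1
  comp : ∀ {m : ℕ} (k : Fin m → ℕ), (obj m ⨯ ∏ᶜ fun i => obj (k i)) ⟶ obj (∑ i, k i)

variable {V}

namespace OperadData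
variable (P : OperadData V)

/-- Operadic composition of generalized elements of shape `X`. -/
noncomputable def op {X : V} {m : ℕ} {k : Fin m → ℕ}
    (p : X ⟶ P.obj m) (q : ∀ i, X ⟶ P.obj (k i)) : X ⟶ P.obj (∑ i, k i) :=
  prod.lift p (Pi.lift q) ≫ P.comp k

/-- The unit of the operad as a generalized element of shape `X`. -/
noncomputable def one (X : V) : X ⟶ P.obj 1 := terminal.from X ≫ P.unit

/-- The identification of `P(m)` with `P(m')` for equal numbers `m` and `m'`. -/
def cast {m m' : ℕ} (h : m = m') : P.obj m ⟶ P.obj m' := eqToHom (congrArg P.obj h)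

end OperadData

variable (V)

/-- A (non-symmetric) operad in a category with finite products: unit laws and associativity. The
laws are stated for generalized elements of all shapes `X`, which by the Yoneda lemma is the
same as the commutativity of the usual diagrams. -/
structure NSOperad extends OperadData V where
  one_op : ∀ {X : V} {k : ℕ} (p : X ⟶ toOperadData.obj k),
    toOperadData.op (toOperadData.one X) (fun _ : Fin 1 => p) ≫ toOperadData.cast (by simp) = p
  op_one : ∀ {X : V} {m : ℕ} (p : X ⟶ toOperadData.obj m),
    toOperadData.op p (fun _ : Fin m => toOperadData.one X) ≫ toOperadData.cast (by simp) = p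
  op_op : ∀ {X : V} {m : ℕ} {k : Fin m → ℕ} {l : ∀ i, Fin (k i) → ℕ} (p : X ⟶ toOperadData.obj m)
    (q : ∀ i, X ⟶ toOperadData.obj (k i)) (r : ∀ i j, X ⟶ toOperadData.obj (l i j)),
    toOperadData.op p (fun i => toOperadData.op (q i) (r i)) ≫ toOperadData.cast (sum_blocks l) =
      toOperadData.op (toOperadData.op p q)
        (fun s => r (finSigmaFinEquiv.symm s).1 (finSigmaFinEquiv.symm s).2)

end

/-! ### `(V, P)`-categories -/

section
variable {V : Type (u + 1)} [Category.{u} V] [HasFiniteProducts V]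

/-- The data of a `(V, P)`-category: a `V`-graph `A` with composition morphisms
`P(k) × A(a₀, a₁) × ⋯ × A(aₖ₋₁, aₖ) ⟶ A(a₀, aₖ)`. -/
structure VPData (P : NSOperad V) : Type (u + 1) extends VGraph V where
  comp : ∀ {k : ℕ} (a : Fin (k + 1) → obj),
    (P.obj k ⨯ toVGraph.string a) ⟶ hom (a 0) (a (Fin.last k))

/-- Composition of generalized elements of shape `X`. -/
noncomputable def VPData.act {P : NSOperad V} (A : VPData P) {X : V} {k : ℕ}
    (a : Fin (k + 1) → A.obj) (p : X ⟶ P.obj k)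
    (x : ∀ i : Fin k, X ⟶ A.hom (a i.castSucc) (a i.succ)) : X ⟶ A.hom (a 0) (a (Fin.last k)) :=
  prod.lift p (Pi.lift x) ≫ A.comp a

/-- A `(V, P)`-category: compatibility of the composition with the unit and with the composition of
the operad, for generalized elements of all shapes `X`. In `act_op` there are a string `a` of
`m + 1` objects, for every `i : Fin m` a string `b i` of `k i + 1` objects from `aᵢ` to `aᵢ₊₁`, and
`c` is the concatenation of the strings `b i`. -/
structure VPCat (P : NSOperad V) : Type (u + 1) extends VPData P where
  act_one : ∀ {X : V} (a : Fin 2 → toVPData.obj)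
    (x : ∀ i : Fin 1, X ⟶ toVPData.hom (a i.castSucc) (a i.succ)),
    toVPData.act a (P.one X) x = x 0
  act_op : ∀ {X : V} {m : ℕ} {k : Fin m → ℕ} (a : Fin (m + 1) → toVPData.obj)
    (b : ∀ i, Fin (k i + 1) → toVPData.obj) (c : Fin ((∑ i, k i) + 1) → toVPData.obj)
    (ha : ∀ i, b i 0 = a i.castSucc) (ha' : ∀ i, b i (Fin.last (k i)) = a i.succ)
    (hc : ∀ i j, b i j.castSucc = c (finSigmaFinEquiv ⟨i, j⟩).castSucc)
    (hc' : ∀ i j, b i j.succ = c (finSigmaFinEquiv ⟨i, j⟩).succ)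
    (h0 : a 0 = c 0) (h1 : a (Fin.last m) = c (Fin.last (∑ i, k i)))
    (p : X ⟶ P.obj m) (q : ∀ i, X ⟶ P.obj (k i))
    (x : ∀ i (j : Fin (k i)), X ⟶ toVPData.hom (b i j.castSucc) (b i j.succ))
    (y : ∀ s : Fin (∑ i, k i), X ⟶ toVPData.hom (c s.castSucc) (c s.succ))
    (_ : ∀ i j, x i j ≫ toVPData.cast (hc i j) (hc' i j) = y (finSigmaFinEquiv ⟨i, j⟩)),
    toVPData.act a p (fun i => toVPData.act (b i) (q i) (x i) ≫ toVPData.cast (ha i) (ha' i)) ≫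
        toVPData.cast h0 h1 =
      toVPData.act c (P.op p q) y

namespace VPCat
variable {P : NSOperad V}

/-- A morphism of `(V, P)`-categories: a morphism of graphs that commutes with composition. -/
structure Hom (A B : VPCat P) : Type u extends VGraph.Hom A.toVGraph B.toVGraph where
  comp_comm : ∀ {k : ℕ} (a : Fin (k + 1) → A.obj),
    A.comp a ≫ hom (a 0) (a (Fin.last k)) =
      prod.map (𝟙 (P.obj k)) (VGraph.stringMap toHom a) ≫ B.comp (fun i => obj (a i))

theorem Hom.ext_toHom {A B : VPCat P} {F G : Hom A B} (h : F.toHom = G.toHom) : F = G := by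
  cases F; cases G; cases h; rfl

instance : Category.{u} (VPCat P) where
  Hom := Hom
  id A := ⟨𝟙 A.toVGraph, fun a => by
    refine (Category.comp_id _).trans ?_
    refine Eq.trans ?_ (congrArg (fun f => prod.map (𝟙 _) f ≫ _) (VGraph.stringMap_id _ a).symm)
    simp⟩
  comp {A B C} F G := ⟨(F.toHom ≫ G.toHom : A.toVGraph ⟶ C.toVGraph), fun a => by
    refine (Category.assoc _ _ _).symm.trans ?_
    refine (congrArg (· ≫ _) (F.comp_comm a)).trans ?_
    refine (Category.assoc _ _ _).trans ?_
    refine (congrArg _ (G.comp_comm _)).trans ?_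
    refine Eq.trans ?_
      (congrArg (fun f => prod.map (𝟙 _) f ≫ _) (VGraph.stringMap_comp _ _ a).symm)
    refine (Category.assoc _ _ _).symm.trans ?_
    exact congrArg (· ≫ _) (prod.map_id_comp _ _).symm⟩
  id_comp {A B} F := Hom.ext_toHom
    (Category.id_comp (X := A.toVGraph) (Y := B.toVGraph) F.toHom)
  comp_id {A B} F := Hom.ext_toHom
    (Category.comp_id (X := A.toVGraph) (Y := B.toVGraph) F.toHom)
  assoc {A B C D} F G H := Hom.ext_toHom (Category.assoc (W := A.toVGraph) (X := B.toVGraph)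
    (Y := C.toVGraph) (Z := D.toVGraph) F.toHom G.toHom H.toHom)

/-- The forgetful functor from `(V, P)`-categories to `V`-graphs. -/
def forget (P : NSOperad V) : VPCat P ⥤ VGraph V where
  obj A := A.toVGraph
  map F := (show Hom _ _ from F).toHom

end VPCat

/-! Products of `(V, P)`-categories, computed on underlying graphs. -/

section
variable {P : NSOperad V} {J : Type} [Finite J] (A : J → VPCat P)

noncomputable def VPData.pi : VPData P where
  obj := ∀ j, (A j).obj
  hom x y := ∏ᶜ fun j => (A j).hom (x j) (y j)
  comp {k} a := Pi.lift fun j => prod.map (𝟙 (P.obj k))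
    (Limits.Pi.map fun i : Fin k => Pi.π (fun j => (A j).hom (a i.castSucc j) (a i.succ j)) j) ≫
      (A j).comp fun i => a i j

noncomputable def VPData.proj (j : J) : VGraph.Hom (VPData.pi A).toVGraph (A j).toVGraph :=
  ⟨fun x => x j, fun x y => Pi.π (fun j => (A j).hom (x j) (y j)) j⟩

theorem VPData.act_proj (j : J) {X : V} {k : ℕ} (a : Fin (k + 1) → (VPData.pi A).obj)
    (p : X ⟶ P.obj k) (x : ∀ i : Fin k, X ⟶ (VPData.pi A).hom (a i.castSucc) (a i.succ)) :
    (VPData.pi A).act a p x ≫ (VPData.proj A j).hom _ _ =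
      (A j).act (fun i => a i j) p (fun i => x i ≫ (VPData.proj A j).hom _ _) := by
  refine (Category.assoc _ _ _).trans ((congrArg _ (Pi.lift_π _ _)).trans ?_)
  refine (Category.assoc _ _ _).symm.trans (congrArg (· ≫ _) ?_)
  refine (prod.lift_map _ _ _ _).trans ?_
  congr 1
  · exact Category.comp_id _
  · refine Pi.hom_ext _ _ fun i => ?_
    refine (Category.assoc _ _ _).trans ((congrArg _ (Limits.Pi.map_π _ _)).trans ?_)
    refine (Category.assoc _ _ _).symm.trans ((congrArg (· ≫ _) (Pi.lift_π _ _)).trans ?_)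
    symm
    exact Pi.lift_π _ _

theorem VPData.pi_ext {X : V} {x y : (VPData.pi A).obj} {f g : X ⟶ (VPData.pi A).hom x y}
    (h : ∀ j, f ≫ (VPData.proj A j).hom x y = g ≫ (VPData.proj A j).hom x y) : f = g :=
  Pi.hom_ext _ _ h

noncomputable def VPCat.pi : VPCat P where
  toVPData := VPData.pi A
  act_one a x := VPData.pi_ext A fun j =>
    (VPData.act_proj A j _ _ _).trans ((A j).act_one _ _)
  act_op {X m k} a b c ha ha' hc hc' h0 h1 p q x y hxy := VPData.pi_ext A fun j => by
    have key : ∀ {x x' y y' : (VPData.pi A).obj} (h : x = x') (h' : y = y')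
        (f : X ⟶ (VPData.pi A).hom x y),
        (f ≫ (VPData.pi A).cast h h') ≫ (VPData.proj A j).hom _ _ =
          (f ≫ (VPData.proj A j).hom _ _) ≫
            (A j).cast (congrFun h j) (congrFun h' j) := by
      rintro x _ y _ rfl rfl f
      exact (congrArg (· ≫ _) (Category.comp_id f)).trans (Category.comp_id _).symm
    rw [key, VPData.act_proj, VPData.act_proj]
    have h := (A j).act_op (fun i => a i j) (fun i s => b i s j) (fun s => c s j)
      (fun i => congrFun (ha i) j) (fun i => congrFun (ha' i) j)
      (fun i s => congrFun (hc i s) j) (fun i s => congrFun (hc' i s) j)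
      (congrFun h0 j) (congrFun h1 j) p q
      (fun i s => x i s ≫ (VPData.proj A j).hom _ _) (fun s => y s ≫ (VPData.proj A j).hom _ _)
      (fun i s => (key _ _ _).symm.trans (congrArg (· ≫ _) (hxy i s)))
    refine Eq.trans ?_ h
    congr 2
    funext i
    refine (key _ _ _).trans (congrArg (· ≫ _) ?_)
    exact VPData.act_proj A j _ _ _

noncomputable def VPCat.fan : Fan A :=
  Fan.mk (VPCat.pi A) fun j => (⟨VPData.proj A j, fun _ => Pi.lift_π _ _⟩ : VPCat.Hom _ _)

/-- The fan of underlying graphs of a fan of `(V, P)`-categories. -/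
def VPCat.graphFan {A : J → VPCat P} (t : Fan A) : Fan fun j => (A j).toVGraph :=
  Fan.mk (t.pt.toVGraph : VGraph V) fun j => (show VPCat.Hom _ _ from t.proj j).toHom

noncomputable def VPCat.fanLift {A : J → VPCat P} (t : Fan A) : VPCat.Hom t.pt (VPCat.pi A) where
  toHom := VGraph.fanLift (VPCat.graphFan t)
  comp_comm {k} a := by
    refine VPData.pi_ext A fun j => ?_
    have h := (show VPCat.Hom _ _ from t.proj j).comp_comm a
    refine (Category.assoc _ _ _).trans ((congrArg _ (Pi.lift_π _ _)).trans (h.trans ?_))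
    symm
    refine (Category.assoc _ _ _).trans ((congrArg _ (Pi.lift_π _ _)).trans ?_)
    refine (Category.assoc _ _ _).symm.trans (congrArg (· ≫ _) ?_)
    refine (prod.map_id_comp _ _).symm.trans (congrArg _ ?_)
    refine Pi.hom_ext _ _ fun i => ?_
    refine (Category.assoc _ _ _).trans ((congrArg _ (Limits.Pi.map_π _ _)).trans ?_)
    refine (Category.assoc _ _ _).symm.trans ((congrArg (· ≫ _) (Limits.Pi.map_π _ _)).trans ?_)
    refine (Category.assoc _ _ _).trans ((congrArg _ (Pi.lift_π _ _)).trans ?_)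
    symm
    exact Limits.Pi.map_π _ _

theorem VPCat.fan_isLimit : Nonempty (IsLimit (VPCat.fan A)) := by
  refine ⟨Fan.IsLimit.mk _ (fun t => VPCat.fanLift t) (fun t j => ?_) fun t m hm => ?_⟩
  · exact VPCat.Hom.ext_toHom (VGraph.mk_eq fun a a' => Pi.lift_π _ _)
  · refine VPCat.Hom.ext_toHom ?_
    refine (VGraph.fan_hom_unique (VPCat.graphFan t) (𝟙 _) fun j => ?_).trans
      (Category.id_comp (VGraph.fanLift (VPCat.graphFan t)))
    rw [Category.id_comp]
    exact congrArg VPCat.Hom.toHom (hm j)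

end

instance (P : NSOperad V) : HasFiniteProducts (VPCat P) :=
  hasFiniteProducts_of_fans fun A => ⟨⟨_, (VPCat.fan_isLimit A).some⟩⟩

end

/-! ### `n`-graphs, their cells, and the free strict `n`-category functor -/

/-- A category with small coproducts and finite products. -/
structure GphCat : Type (u + 2) where
  C : Type (u + 1)
  [cat : Category.{u} C]
  [coprod : HasCoproducts.{u} C]
  [prod : HasFiniteProducts C]

attribute [instance] GphCat.cat GphCat.coprod GphCat.prod

/-- The category of `n`-graphs: sets for `n = 0`, and graphs enriched in `n`-graphs for `n + 1`.
It is equivalent to the category of `n`-dimensional globular sets. -/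
def gphCat : ℕ → GphCat.{u}
  | 0 => ⟨Type u⟩
  | n + 1 => ⟨VGraph (gphCat n).C⟩

abbrev NGph (n : ℕ) : Type (u + 1) := (gphCat.{u} n).C

namespace NGph

/-- The set of `m`-cells of the `n`-dimensional globular set corresponding to an `n`-graph. -/
def Cell : (n : ℕ) → NGph.{u} n → ℕ → Type u
  | 0, A, 0 => (A : Type u)
  | 0, _, _ + 1 => PEmpty
  | _ + 1, A, 0 => VGraph.obj A
  | n + 1, A, m + 1 => Σ a a' : VGraph.obj A, Cell n (VGraph.hom A a a') m

def src : {n : ℕ} → {A : NGph.{u} n} → {m : ℕ} → Cell n A (m + 1) → Cell n A m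
  | 0, _, _, x => PEmpty.elim x
  | _ + 1, _, 0, x => x.1
  | _ + 1, _, _ + 1, x => ⟨x.1, x.2.1, src x.2.2⟩

def tgt : {n : ℕ} → {A : NGph.{u} n} → {m : ℕ} → Cell n A (m + 1) → Cell n A m
  | 0, _, _, x => PEmpty.elim x
  | _ + 1, _, 0, x => x.2.1
  | _ + 1, _, _ + 1, x => ⟨x.1, x.2.1, tgt x.2.2⟩

def mapCell : {n : ℕ} → {A B : NGph.{u} n} → (A ⟶ B) → {m : ℕ} → Cell n A m → Cell n B m
  | 0, A, B, f, 0, x => (ConcreteCategory.hom (C := Type u) (X := A) (Y := B) f).toFun x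
  | 0, _, _, _, _ + 1, x => PEmpty.elim x
  | _ + 1, _, _, f, 0, x => VGraph.Hom.obj f x
  | _ + 1, _, _, f, _ + 1, x => ⟨_, _, mapCell (VGraph.Hom.hom f x.1 x.2.1) x.2.2⟩

/-- Two `m`-cells are parallel if `m = 0`, or if they have the same source and the same target. -/
def Parallel {n : ℕ} {A : NGph.{u} n} : {m : ℕ} → Cell n A m → Cell n A m → Prop
  | 0, _, _ => True
  | _ + 1, x, y => src x = src y ∧ tgt x = tgt y

end NGph

/-- The underlying functor of the free strict `n`-category monad `T⁽ⁿ⁾` on `n`-graphs: first form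
free composites in the hom-`(n-1)`-graphs, and then free composites along `0`-cells. -/
noncomputable def strictFree : (n : ℕ) → NGph.{u} n ⥤ NGph.{u} n
  | 0 => 𝟭 _
  | n + 1 => VGraph.map (strictFree n) ⋙ VGraph.fc (V := NGph n)

/-- The category of `T⁽ⁿ⁾`-collections: the slice over `T⁽ⁿ⁾1`. -/
abbrev Collection (n : ℕ) := Over ((strictFree.{u} n).obj (⊤_ NGph n))

/-- Contractibility of a `T⁽ⁿ⁾`-collection `p : A ⟶ T⁽ⁿ⁾1`. -/
structure Collection.IsContractible {n : ℕ} (A : Collection.{u} n) : Prop where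
  /-- Let `a`, `b` be parallel `m`-cells of `A` with `m < n`. Then every `(m+1)`-cell
  `y : p a ⟶ p b` lifts to an `(m+1)`-cell `x : a ⟶ b`. -/
  lift : ∀ m < n, ∀ a b : NGph.Cell n A.left m, NGph.Parallel a b →
    ∀ y : NGph.Cell n ((strictFree n).obj (⊤_ NGph n)) (m + 1),
      NGph.src y = NGph.mapCell A.hom a → NGph.tgt y = NGph.mapCell A.hom b →
        ∃ x : NGph.Cell n A.left (m + 1),
          NGph.src x = a ∧ NGph.tgt x = b ∧ NGph.mapCell A.hom x = y
  /-- Parallel `n`-cells of `A` over the same `n`-cell of `T⁽ⁿ⁾1` are equal: all cells above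
  dimension `n` are identities. -/
  eq : ∀ a b : NGph.Cell n A.left n, NGph.Parallel a b →
    NGph.mapCell A.hom a = NGph.mapCell A.hom b → a = b

/-! ### Iterative operadic theories of `n`-categories -/

/-- A candidate for the category of `n`-categories: a category with finite products, with a notion
of contractibility for its objects, and with a functor to `n`-graphs. -/
structure Stage (n : ℕ) : Type (u + 2) where
  C : Type (u + 1)
  [cat : Category.{u} C]
  [prod : HasFiniteProducts C]
  IsContractible : C → Prop
  U : C ⥤ NGph.{u} n

attribute [instance] Stage.cat Stage.prod

/-- The category of sets. A set is contractible if it is terminal. -/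
def Stage.set : Stage.{u} 0 where
  C := Type u
  IsContractible X := Nonempty (IsTerminal X)
  U := 𝟭 (Type u)

/-- A graph is contractible if it has an object and all its hom-objects are contractible. -/
structure VGraph.IsContractible {V : Type (u + 1)} [Category.{u} V] (c : V → Prop)
    (A : VGraph V) : Prop where
  nonempty : Nonempty A.obj
  hom : ∀ a a', c (A.hom a a')

/-- The category of `(V, P)`-categories. A `(V, P)`-category is contractible if its underlying
`V`-graph is contractible. -/
def Stage.enrich {n : ℕ} (S : Stage.{u} n) (P : NSOperad S.C) : Stage.{u} (n + 1) where
  C := VPCat P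
  IsContractible A := A.toVGraph.IsContractible S.IsContractible
  U := VPCat.forget P ⋙ VGraph.map S.U

/-- An operad is contractible if all `P(k)` are contractible. -/
def Stage.OperadIsContractible {n : ℕ} (S : Stage.{u} n) (P : NSOperad S.C) : Prop :=
  ∀ k, S.IsContractible (P.obj k)

/-- The data of an iterative operadic theory of `n`-categories: categories `V₀, V₁, …` and
operads `Pₙ` in `Vₙ` such that `V₀` is the category of sets and `Vₙ₊₁` is the category of
`(Vₙ, Pₙ)`-categories. Contractibility of the operads is not assumed. -/
structure Theory where
  V : ∀ n, Stage.{u} n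
  P : ∀ n, NSOperad (V n).C
  zero : V 0 = Stage.set
  succ : ∀ n, V (n + 1) = (V n).enrich (P n)

namespace Theory

/-- The sequence of `n`-graphs underlying the operad `Pₙ`. -/
def UP (𝒯 : Theory.{u}) (n : ℕ) (k : ℕ) : NGph.{u} n := (𝒯.V n).U.obj ((𝒯.P n).obj k)

/-- The underlying functor of the free `n`-category monad `Q⁽ⁿ⁾` on `n`-graphs: first form free
composites in the hom-`(n-1)`-graphs, and then free composites along `0`-cells, parametrised by the
operad `Pₙ₋₁`. -/
noncomputable def Q (𝒯 : Theory.{u}) : (n : ℕ) → NGph.{u} n ⥤ NGph.{u} n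
  | 0 => 𝟭 _
  | n + 1 => VGraph.map (Q 𝒯 n) ⋙ VGraph.fcP (V := NGph n) (𝒯.UP n)

/-- The transformation `Q⁽ⁿ⁾ ⟶ T⁽ⁿ⁾` that exhibits `Q⁽ⁿ⁾` as a globular operad. It is induced by the
operad morphisms from the `Pᵢ` to the terminal operads. -/
noncomputable def proj (𝒯 : Theory.{u}) : (n : ℕ) → 𝒯.Q n ⟶ strictFree.{u} n
  | 0 => 𝟙 _
  | n + 1 => NatTrans.hcomp (VGraph.mapNat (proj 𝒯 n)) (VGraph.fcPToFc (V := NGph n) (𝒯.UP n))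

/-- The underlying collection `Q⁽ⁿ⁾1 ⟶ T⁽ⁿ⁾1` of the globular operad `Q⁽ⁿ⁾`. A globular operad is
contractible if its underlying collection is. -/
noncomputable def collection (𝒯 : Theory.{u}) (n : ℕ) : Collection.{u} n :=
  Over.mk ((𝒯.proj n).app (⊤_ NGph n))

end Theory

end IterOp

namespace IterOp

/-! ### Cells and trivial fibrations of `n`-graphs -/

namespace NGph

/-! Call a morphism of `n`-graphs a trivial fibration if it is contractible and surjective on
0-cells. Contractibility shifts dimension: a morphism of `(n+1)`-graphs is contractible exactly when
it is a trivial fibration on every hom-object (`isContractibleMap_succ_iff`). For `Q⁽ⁿ⁺¹⁾1 ⟶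
T⁽ⁿ⁺¹⁾1` the morphism on a hom-object is, up to isomorphism, a coproduct over strings of the
morphisms `Pₙ(k) × (Q⁽ⁿ⁾1)ᵏ ⟶ (T⁽ⁿ⁾1)ᵏ`, and a coproduct is a trivial fibration if and only if each
summand is (`trivialFib_sigmaMap_iff`). So everything reduces to these morphisms, for all `k`, and
to an induction on `n`.

If `Pₙ(k) ⟶ 1` and `Q⁽ⁿ⁾1 ⟶ T⁽ⁿ⁾1` are trivial fibrations, so are these morphisms, because trivial
fibrations are closed under finite products (`trivialFib_piMap`). For the converse, trivial
fibrations are closed under retracts. The unit of `Pₙ` makes `Q⁽ⁿ⁾1 ⟶ T⁽ⁿ⁾1` a retract of the case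
`k = 1`, and a global point of `Q⁽ⁿ⁾1` makes `Pₙ(k) ⟶ 1` a retract of case `k`. Finally, `Pₙ(k)` is
contractible if and only if its underlying `n`-graph is trivially fibred over the terminal one
(`Stage.DetectsContractible`). -/

theorem mapCell_id : ∀ {n : ℕ} (A : NGph.{u} n) {m : ℕ} (x : Cell n A m), mapCell (𝟙 A) x = x
  | 0, _, 0, _ => rfl
  | 0, _, _ + 1, x => PEmpty.elim x
  | _ + 1, _, 0, _ => rfl
  | n + 1, A, m + 1, ⟨a, a', x⟩ =>
    congrArg (fun y => (⟨a, a', y⟩ : Cell (n + 1) A (m + 1))) (mapCell_id (VGraph.hom A a a') x)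

theorem mapCell_comp : ∀ {n : ℕ} {A B C : NGph.{u} n} (f : A ⟶ B) (g : B ⟶ C) {m : ℕ}
    (x : Cell n A m), mapCell (f ≫ g) x = mapCell g (mapCell f x)
  | 0, _, _, _, _, _, 0, _ => rfl
  | 0, _, _, _, _, _, _ + 1, x => PEmpty.elim x
  | _ + 1, _, _, _, _, _, 0, _ => rfl
  | n + 1, _, _, C, f, g, m + 1, ⟨a, a', x⟩ =>
    congrArg (fun y => (⟨_, _, y⟩ : Cell (n + 1) C (m + 1)))
      (mapCell_comp (VGraph.Hom.hom f a a') (VGraph.Hom.hom g _ _) x)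

theorem src_mapCell : ∀ {n : ℕ} {A B : NGph.{u} n} (f : A ⟶ B) {m : ℕ}
    (x : Cell n A (m + 1)), src (mapCell f x) = mapCell f (src x)
  | 0, _, _, _, _, x => PEmpty.elim x
  | _ + 1, _, _, _, 0, _ => rfl
  | n + 1, _, B, f, m + 1, ⟨a, a', x⟩ =>
    congrArg (fun y => (⟨_, _, y⟩ : Cell (n + 1) B (m + 1))) (src_mapCell (VGraph.Hom.hom f a a') x)

theorem tgt_mapCell : ∀ {n : ℕ} {A B : NGph.{u} n} (f : A ⟶ B) {m : ℕ}
    (x : Cell n A (m + 1)), tgt (mapCell f x) = mapCell f (tgt x)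
  | 0, _, _, _, _, x => PEmpty.elim x
  | _ + 1, _, _, _, 0, _ => rfl
  | n + 1, _, B, f, m + 1, ⟨a, a', x⟩ =>
    congrArg (fun y => (⟨_, _, y⟩ : Cell (n + 1) B (m + 1))) (tgt_mapCell (VGraph.Hom.hom f a a') x)

theorem Parallel.mapCell {n : ℕ} {A B : NGph.{u} n} (f : A ⟶ B) {m : ℕ} {a b : Cell n A m}
    (h : Parallel a b) : Parallel (mapCell f a) (mapCell f b) := by
  cases m with
  | zero => trivial
  | succ m =>
    exact ⟨by rw [src_mapCell, src_mapCell, h.1], by rw [tgt_mapCell, tgt_mapCell, h.2]⟩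

/-- The morphisms of `n`-graphs that are contractible as collections over their codomain. -/
structure IsContractibleMap {n : ℕ} {A B : NGph.{u} n} (f : A ⟶ B) : Prop where
  lift : ∀ m < n, ∀ a b : Cell n A m, Parallel a b → ∀ y : Cell n B (m + 1),
    src y = NGph.mapCell f a → tgt y = NGph.mapCell f b →
      ∃ x : Cell n A (m + 1), src x = a ∧ tgt x = b ∧ NGph.mapCell f x = y
  eq : ∀ a b : Cell n A n, Parallel a b → NGph.mapCell f a = NGph.mapCell f b → a = b

/-- The trivial fibrations: contractible morphisms of `n`-graphs that are surjective on
`0`-cells. -/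
def trivialFib (n : ℕ) : MorphismProperty (NGph.{u} n) := fun A B f =>
  IsContractibleMap f ∧ Function.Surjective (mapCell f : Cell n A 0 → Cell n B 0)

/-- A lifting problem for the retract is pushed forward along the section, solved there, and its
solution brought back along the retraction. Invariance under isomorphism of arrows also follows from
this. -/
instance (n : ℕ) : (trivialFib.{u} n).IsStableUnderRetracts where
  of_retract {A B A' B' f g} h hg := by
    have hl : ∀ {m : ℕ} (x : Cell n A m), mapCell h.r.left (mapCell h.i.left x) = x := fun x => by
      rw [← mapCell_comp, h.retract_left]
      exact mapCell_id A x
    have hr : ∀ {m : ℕ} (x : Cell n B m), mapCell h.r.right (mapCell h.i.right x) = x := fun x => by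
      rw [← mapCell_comp, h.retract_right]
      exact mapCell_id B x
    have hi : ∀ {m : ℕ} (x : Cell n A m),
        mapCell g (mapCell h.i.left x) = mapCell h.i.right (mapCell f x) := fun x => by
      rw [← mapCell_comp, ← mapCell_comp, h.i_w]
    have hr' : ∀ {m : ℕ} (x : Cell n A' m),
        mapCell f (mapCell h.r.left x) = mapCell h.r.right (mapCell g x) := fun x => by
      rw [← mapCell_comp, ← mapCell_comp, h.r_w]
    refine ⟨⟨fun m hm a b hab y hy hy' => ?_, fun a b hab e => ?_⟩, fun y => ?_⟩
    · obtain ⟨x, rfl', rfl'', hx⟩ := hg.1.lift m hm _ _ (hab.mapCell h.i.left)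
        (mapCell h.i.right y) (by rw [src_mapCell, hi, hy]) (by rw [tgt_mapCell, hi, hy'])
      refine ⟨mapCell h.r.left x, ?_, ?_, ?_⟩
      · rw [src_mapCell, rfl', hl]
      · rw [tgt_mapCell, rfl'', hl]
      · rw [hr', hx, hr]
    · rw [← hl a, hg.1.eq _ _ (hab.mapCell h.i.left) (by rw [hi, hi, e]), hl]
    · obtain ⟨x, hx⟩ := hg.2 (mapCell h.i.right y)
      exact ⟨mapCell h.r.left x, by rw [hr', hx, hr]⟩

/-- In dimension 0 there is nothing to lift, and all 0-cells are parallel, so condition (ii) is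
injectivity. -/
theorem trivialFib_zero_iff {A B : NGph.{u} 0} (f : A ⟶ B) :
    trivialFib 0 f ↔ Function.Bijective (mapCell f : Cell 0 A 0 → Cell 0 B 0) :=
  ⟨fun h => ⟨fun a b e => h.1.eq a b trivial e, h.2⟩, fun h =>
    ⟨⟨fun _ hm => absurd hm (Nat.not_lt_zero _), fun _ _ _ e => h.1 e⟩, h.2⟩⟩

theorem parallel_mk {n : ℕ} {A : NGph.{u} (n + 1)} {a a' : VGraph.obj A} {m : ℕ}
    {x y : Cell n (VGraph.hom A a a') m} (h : Parallel x y) :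
    Parallel (n := n + 1) (A := A) (m := m + 1) ⟨a, a', x⟩ ⟨a, a', y⟩ := by
  cases m with
  | zero => exact ⟨rfl, rfl⟩
  | succ m =>
    exact ⟨congrArg (fun z => (⟨a, a', z⟩ : Cell (n + 1) A (m + 1))) h.1,
      congrArg (fun z => (⟨a, a', z⟩ : Cell (n + 1) A (m + 1))) h.2⟩

theorem mk_injective {n : ℕ} {A : NGph.{u} (n + 1)} {a a' : VGraph.obj A} {m : ℕ}
    {x y : Cell n (VGraph.hom A a a') m}
    (h : (⟨a, a', x⟩ : Cell (n + 1) A (m + 1)) = (⟨a, a', y⟩ : Cell (n + 1) A (m + 1))) :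
    x = y := by
  cases h; rfl

/-- Parallel cells of positive dimension have the same bounding 0-cells, hence lie in a single
hom-object. -/
theorem Parallel.exists_eq_mk {n : ℕ} {A : NGph.{u} (n + 1)} {m : ℕ}
    {x y : Cell (n + 1) A (m + 1)} (h : Parallel x y) :
    ∃ (a a' : VGraph.obj A) (x' y' : Cell n (VGraph.hom A a a') m),
      x = ⟨a, a', x'⟩ ∧ y = ⟨a, a', y'⟩ ∧ Parallel x' y' := by
  obtain ⟨a, a', x⟩ := x
  obtain ⟨b, b', y⟩ := y
  cases m with
  | zero =>
    obtain ⟨h, h'⟩ := h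
    obtain rfl : a = b := h
    obtain rfl : a' = b' := h'
    exact ⟨a, a', x, y, rfl, rfl, trivial⟩
  | succ m =>
    obtain ⟨h, h'⟩ := h
    obtain rfl : a = b := congrArg Sigma.fst h
    obtain rfl : a' = b' := congrArg (fun z : Cell (n + 1) A (m + 1) => z.2.1) h
    exact ⟨a, a', x, y, rfl, rfl, mk_injective h, mk_injective h'⟩

/-- Lifting 1-cells between given 0-cells is surjectivity on 0-cells of the hom-objects. The lifting
of higher cells and condition (ii) are those of the hom-objects, one dimension lower. -/
theorem isContractibleMap_succ_iff {n : ℕ} {A B : NGph.{u} (n + 1)} (f : A ⟶ B) :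
    IsContractibleMap f ↔ ∀ a a' : VGraph.obj A, trivialFib n (VGraph.Hom.hom f a a') := by
  constructor
  · refine fun h a a' => ⟨⟨fun m hm x y hxy z hz hz' => ?_, fun x y hxy e => ?_⟩, fun y => ?_⟩
    · obtain ⟨⟨c, c', w⟩, hw, hw', hw''⟩ := h.lift (m + 1) (Nat.succ_lt_succ hm) ⟨a, a', x⟩
        ⟨a, a', y⟩ (parallel_mk hxy) ⟨_, _, z⟩
        (congrArg (fun t => (⟨_, _, t⟩ : Cell (n + 1) B (m + 1))) hz)
        (congrArg (fun t => (⟨_, _, t⟩ : Cell (n + 1) B (m + 1))) hz')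
      obtain rfl : c = a := congrArg Sigma.fst hw
      obtain rfl : c' = a' := congrArg (fun z : Cell (n + 1) A (m + 1) => z.2.1) hw
      exact ⟨w, mk_injective hw, mk_injective hw', mk_injective hw''⟩
    · exact mk_injective (h.eq ⟨a, a', x⟩ ⟨a, a', y⟩ (parallel_mk hxy)
        (congrArg (fun t => (⟨_, _, t⟩ : Cell (n + 1) B (n + 1))) e))
    · obtain ⟨⟨c, c', w⟩, hw, hw', hw''⟩ :=
        h.lift 0 (Nat.succ_pos n) a a' trivial ⟨_, _, y⟩ rfl rfl
      obtain rfl : c = a := hw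
      obtain rfl : c' = a' := hw'
      exact ⟨w, mk_injective hw''⟩
  · refine fun h => ⟨fun m hm x y hxy z hz hz' => ?_, fun x y hxy e => ?_⟩
    · cases m with
      | zero =>
        obtain ⟨b, b', w⟩ := z
        obtain rfl : b = _ := hz
        obtain rfl : b' = _ := hz'
        obtain ⟨v, hv⟩ := (h x y).2 w
        exact ⟨⟨x, y, v⟩, rfl, rfl, congrArg (fun t => (⟨_, _, t⟩ : Cell (n + 1) B 1)) hv⟩
      | succ m =>
        obtain ⟨a, a', x, y, rfl, rfl, hxy'⟩ := hxy.exists_eq_mk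
        obtain ⟨b, b', w⟩ := z
        obtain rfl : b = _ := congrArg Sigma.fst hz
        obtain rfl : b' = _ := congrArg (fun z : Cell (n + 1) B (m + 1) => z.2.1) hz
        obtain ⟨v, hv, hv', hv''⟩ := (h a a').1.lift m (Nat.lt_of_succ_lt_succ hm) x y hxy' w
          (mk_injective hz) (mk_injective hz')
        exact ⟨⟨a, a', v⟩, congrArg (fun t => (⟨_, _, t⟩ : Cell (n + 1) A (m + 1))) hv,
          congrArg (fun t => (⟨_, _, t⟩ : Cell (n + 1) A (m + 1))) hv',
          congrArg (fun t => (⟨_, _, t⟩ : Cell (n + 1) B (m + 2))) hv''⟩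
    · obtain ⟨a, a', x, y, rfl, rfl, hxy'⟩ := hxy.exists_eq_mk
      exact congrArg (fun t => (⟨_, _, t⟩ : Cell (n + 1) A (n + 1)))
        ((h a a').1.eq x y hxy' (mk_injective e))

theorem trivialFib_succ_iff {n : ℕ} {A B : NGph.{u} (n + 1)} (f : A ⟶ B) :
    trivialFib (n + 1) f ↔ Function.Surjective (VGraph.Hom.obj f) ∧
      ∀ a a' : VGraph.obj A, trivialFib n (VGraph.Hom.hom f a a') :=
  (and_congr_left' (isContractibleMap_succ_iff f)).trans and_comm

end NGph

/-! ### Products and coproducts of trivial fibrations -/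

namespace VGraph

section
variable {V : Type (u + 1)} [Category.{u} V]

/-- An explicit model of the product of morphisms: unlike those of the chosen product, its action on
objects and on hom-objects can be read off. -/
noncomputable def fanMap [HasFiniteProducts V] {J : Type} [Finite J] {A B : J → VGraph V}
    (f : ∀ j, A j ⟶ B j) : (fan A).pt ⟶ (fan B).pt :=
  ⟨fun x j => Hom.obj (f j) (x j), fun x y => Limits.Pi.map fun j => Hom.hom (f j) (x j) (y j)⟩

theorem fanMap_proj [HasFiniteProducts V] {J : Type} [Finite J] {A B : J → VGraph V}
    (f : ∀ j, A j ⟶ B j) (j : J) :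
    fanMap f ≫ (fan B).proj j = (fan A).proj j ≫ f j :=
  mk_eq fun x y => Limits.Pi.map_π (fun j => Hom.hom (f j) (x j) (y j)) j

/-- The morphisms between the summands of the hom-objects of two coproducts of graphs. -/
def cofanMapHom {J : Type u} {A B : J → VGraph V} (f : ∀ j, A j ⟶ B j) (x y : Σ j, (A j).obj)
    (h : ULift.{u} (PLift (x.1 = y.1))) : (A y.1).hom (h.down.down ▸ x.2) y.2 ⟶
      (B y.1).hom (h.down.down ▸ Hom.obj (f x.1) x.2) (Hom.obj (f y.1) y.2) :=
  match x, y, h with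
  | ⟨_, a⟩, ⟨_, a'⟩, ⟨⟨rfl⟩⟩ => Hom.hom (f _) a a'

noncomputable def cofanMap [HasCoproducts.{u} V] {J : Type u} {A B : J → VGraph V}
    (f : ∀ j, A j ⟶ B j) : (cofan A).pt ⟶ (cofan B).pt :=
  ⟨fun x => ⟨x.1, Hom.obj (f x.1) x.2⟩, fun x y => Limits.Sigma.map (cofanMapHom f x y)⟩

theorem inj_cofanMap [HasCoproducts.{u} V] {J : Type u} {A B : J → VGraph V}
    (f : ∀ j, A j ⟶ B j) (j : J) :
    (cofan A).inj j ≫ cofanMap f = f j ≫ (cofan B).inj j :=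
  mk_eq fun a a' => Limits.Sigma.ι_map (cofanMapHom f ⟨j, a⟩ ⟨j, a'⟩) ⟨⟨rfl⟩⟩

end

end VGraph

namespace NGph

/-- The morphism between the tips of two limit fans can replace that between the chosen products. -/
theorem trivialFib_piMap_iff_of_isLimit {n : ℕ} {J : Type} [Finite J] {A B : J → NGph.{u} n}
    (f : ∀ j, A j ⟶ B j) {s : Fan A} {t : Fan B} (hs : IsLimit s) (ht : IsLimit t)
    (g : s.pt ⟶ t.pt) (hg : ∀ j, g ≫ t.proj j = s.proj j ≫ f j) :
    trivialFib n (Limits.Pi.map f) ↔ trivialFib n g := by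
  refine (trivialFib n).arrow_mk_iso_iff (Arrow.isoMk
    ((productIsProduct A).conePointUniqueUpToIso hs)
    ((productIsProduct B).conePointUniqueUpToIso ht) ?_)
  refine Fan.IsLimit.hom_ext ht _ _ fun j => ?_
  have h1 : ((productIsProduct A).conePointUniqueUpToIso hs).hom ≫ s.proj j = Pi.π A j :=
    (productIsProduct A).conePointUniqueUpToIso_hom_comp hs ⟨j⟩
  have h2 : ((productIsProduct B).conePointUniqueUpToIso ht).hom ≫ t.proj j = Pi.π B j :=
    (productIsProduct B).conePointUniqueUpToIso_hom_comp ht ⟨j⟩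
  have h3 := Limits.Pi.map_π f j
  simp only [Arrow.mk_hom, Category.assoc]
  rw [h2, hg, reassoc_of% h1, h3]

theorem trivialFib_sigmaMap_iff_of_isColimit {n : ℕ} {J : Type u} {A B : J → NGph.{u} n}
    (f : ∀ j, A j ⟶ B j) {s : Cofan A} {t : Cofan B} (hs : IsColimit s) (ht : IsColimit t)
    (g : s.pt ⟶ t.pt) (hg : ∀ j, s.inj j ≫ g = f j ≫ t.inj j) :
    trivialFib n (Limits.Sigma.map f) ↔ trivialFib n g := by
  refine (trivialFib n).arrow_mk_iso_iff (Arrow.isoMk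
    ((coproductIsCoproduct A).coconePointUniqueUpToIso hs)
    ((coproductIsCoproduct B).coconePointUniqueUpToIso ht) ?_)
  refine Limits.Sigma.hom_ext _ _ fun j => ?_
  have h1 : Sigma.ι A j ≫ ((coproductIsCoproduct A).coconePointUniqueUpToIso hs).hom = s.inj j :=
    (coproductIsCoproduct A).comp_coconePointUniqueUpToIso_hom hs ⟨j⟩
  have h2 : Sigma.ι B j ≫ ((coproductIsCoproduct B).coconePointUniqueUpToIso ht).hom = t.inj j :=
    (coproductIsCoproduct B).comp_coconePointUniqueUpToIso_hom ht ⟨j⟩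
  have h3 := Limits.Sigma.ι_map f j
  simp only [Arrow.mk_hom]
  rw [reassoc_of% h1, hg, reassoc_of% h3, h2]

theorem trivialFib_zero_iff_isIso {A B : NGph.{u} 0} (f : A ⟶ B) :
    trivialFib 0 f ↔ IsIso f :=
  (trivialFib_zero_iff f).trans (isIso_iff_bijective (X := (A : Type u)) (Y := (B : Type u)) f).symm

/-- In dimension 0 trivial fibrations are isomorphisms. Above it, preimages of objects are chosen
componentwise, and the hom-objects of a product are products, to which induction applies. -/
theorem trivialFib_piMap {n : ℕ} {J : Type} [Finite J] {A B : J → NGph.{u} n}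
    (f : ∀ j, A j ⟶ B j) (hf : ∀ j, trivialFib n (f j)) : trivialFib n (Limits.Pi.map f) := by
  induction n with
  | zero =>
    have := fun j => (trivialFib_zero_iff_isIso (f j)).1 (hf j)
    exact (trivialFib_zero_iff_isIso _).2 inferInstance
  | succ n ih =>
    refine (trivialFib_piMap_iff_of_isLimit f (VGraph.fan_isLimit (V := NGph n) A).some
      (VGraph.fan_isLimit (V := NGph n) B).some (VGraph.fanMap (V := NGph n) f)
      (VGraph.fanMap_proj (V := NGph n) f)).2
        ((trivialFib_succ_iff _).2 ⟨fun y => ?_, fun x y => ?_⟩)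
    · choose x hx using fun j => ((trivialFib_succ_iff _).1 (hf j)).1 (y j)
      exact ⟨x, funext hx⟩
    · exact ih _ fun j => ((trivialFib_succ_iff _).1 (hf j)).2 _ _

/-- A coproduct of graphs is a disjoint union on objects, so surjectivity is tested in each summand.
Its hom-objects are themselves coproducts, indexed by proofs that two indices agree (empty between
different summands); hence the index type has to vary in the induction. -/
theorem trivialFib_sigmaMap_iff {n : ℕ} {J : Type u} {A B : J → NGph.{u} n}
    (f : ∀ j, A j ⟶ B j) : trivialFib n (Limits.Sigma.map f) ↔ ∀ j, trivialFib n (f j) := by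
  induction n generalizing J with
  | zero =>
    constructor
    · let F : (Σ j, (A j : Type u)) ⟶ (Σ j, (B j : Type u)) :=
        TypeCat.ofHom fun x => ⟨x.1, mapCell (f x.1) (m := 0) x.2⟩
      intro h
      have hF := (trivialFib_zero_iff _).1 <|
        (trivialFib_sigmaMap_iff_of_isColimit f (Types.coproductColimitCocone.{u, u} A).isColimit
        (Types.coproductColimitCocone.{u, u} B).isColimit F (fun j => rfl)).1 h
      refine fun j => (trivialFib_zero_iff _).2 ⟨fun x y e => ?_, fun y => ?_⟩
      · have : (⟨j, x⟩ : Σ j, (A j : Type u)) = ⟨j, y⟩ :=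
          hF.1 (congrArg (Sigma.mk (β := fun j => (B j : Type u)) j) e)
        cases this; rfl
      · obtain ⟨⟨i, x⟩, hx⟩ := hF.2 (⟨j, y⟩ : Σ j, (B j : Type u))
        obtain rfl : i = j := congrArg Sigma.fst hx
        exact ⟨x, eq_of_heq (Sigma.mk.inj hx).2⟩
    · intro h
      have := fun j => (trivialFib_zero_iff_isIso (f j)).1 (h j)
      exact (trivialFib_zero_iff_isIso _).2 inferInstance
  | succ n ih =>
    refine (trivialFib_sigmaMap_iff_of_isColimit f (VGraph.cofan_isColimit (V := NGph n) A).some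
      (VGraph.cofan_isColimit (V := NGph n) B).some (VGraph.cofanMap (V := NGph n) f)
      (VGraph.inj_cofanMap (V := NGph n) f)).trans ((trivialFib_succ_iff _).trans
      ⟨fun h j => (trivialFib_succ_iff _).2 ⟨fun y => ?_, fun x y => ?_⟩,
       fun h => ⟨fun y => ?_, fun x y => (ih (VGraph.cofanMapHom f x y)).2 ?_⟩⟩)
    · obtain ⟨⟨i, x⟩, hx⟩ := h.1 ⟨j, y⟩
      obtain rfl : i = j := congrArg Sigma.fst hx
      exact ⟨x, eq_of_heq (Sigma.mk.inj hx).2⟩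
    · exact (ih (VGraph.cofanMapHom f ⟨j, x⟩ ⟨j, y⟩)).1 (h.2 ⟨j, x⟩ ⟨j, y⟩) ⟨⟨rfl⟩⟩
    · obtain ⟨x, hx⟩ := ((trivialFib_succ_iff _).1 (h y.1)).1 y.2
      exact ⟨⟨y.1, x⟩, congrArg (Sigma.mk y.1) hx⟩
    · obtain ⟨j, x⟩ := x
      obtain ⟨j', y⟩ := y
      rintro ⟨⟨e⟩⟩
      obtain rfl : j = j' := e
      exact ((trivialFib_succ_iff _).1 (h j)).2 x y

end NGph

/-! ### Terminal graphs -/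

namespace VGraph

section
variable {V : Type (u + 1)} [Category.{u} V] [HasTerminal V]

/-- The identity of a terminal graph factors through the graph with one object and terminal
hom-object, so there is only one object. -/
theorem exists_eq_of_isTerminal {Z : VGraph V} (hZ : IsTerminal Z) : ∃ z, ∀ a : Z.obj, a = z := by
  let M : VGraph V := ⟨PUnit, fun _ _ => ⊤_ V⟩
  let r : Z ⟶ M := ⟨fun _ => ⟨⟩, fun _ _ => terminal.from _⟩
  exact ⟨Hom.obj (hZ.from M) ⟨⟩,
    fun a => congrFun (congrArg Hom.obj (hZ.hom_ext (𝟙 Z) (r ≫ hZ.from M))) a⟩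

/-- A morphism from `X` into a hom-object is a graph morphism from the one-object graph with
hom-object `X`, and such a graph morphism is unique. -/
theorem isTerminal_hom {Z : VGraph V} (hZ : IsTerminal Z) (a b : Z.obj) :
    Nonempty (IsTerminal (Z.hom a b)) := by
  obtain ⟨z, hz⟩ := exists_eq_of_isTerminal hZ
  obtain rfl := hz a
  obtain rfl := hz b
  let G (X : V) : VGraph V := ⟨PUnit, fun _ _ => X⟩
  refine ⟨IsTerminal.ofUniqueHom
    (fun X => Hom.hom (hZ.from (G X)) ⟨⟩ ⟨⟩ ≫ Z.cast (hz _) (hz _)) fun X f => ?_⟩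
  exact (hom_congr (hZ.hom_ext (hZ.from (G X)) (⟨fun _ => b, fun _ _ => f⟩ : Hom (G X) Z))
    ⟨⟩ ⟨⟩).symm

end

end VGraph

/-! ### Retracts and products with a factor that is forgotten -/

section
variable {C : Type (u + 1)} [Category.{u} C] [HasFiniteProducts C]

theorem isIso_prod_snd {T : C} (hT : IsTerminal T) (B : C) : IsIso (prod.snd : T ⨯ B ⟶ B) :=
  ⟨prod.lift (hT.from B) (𝟙 B), Limits.prod.hom_ext (hT.hom_ext _ _) (by simp [prod.lift_snd]),
    prod.lift_snd _ _⟩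

/-- A morphism `f : A ⟶ B` is a retract of `P × Aʲ ⟶ Bʲ` if `j ≠ 0` and there is a morphism from
`A` to `P`. -/
noncomputable def retractSndCompPiMap {P A B : C} {J : Type} [Finite J] (j : J) (p : A ⟶ P)
    (f : A ⟶ B) :
    RetractArrow f ((prod.snd : (P ⨯ ∏ᶜ fun _ : J => A) ⟶ _) ≫ Limits.Pi.map fun _ => f) where
  -- The section is the diagonal, with `p` filling the factor `P`; the projection to component `j`
  -- retracts it.
  i := Arrow.homMk (prod.lift p (Pi.lift fun _ => 𝟙 A)) (Pi.lift fun _ => 𝟙 B)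
    (Pi.hom_ext _ _ fun j => by simp [prod.lift_snd_assoc])
  r := Arrow.homMk (prod.snd ≫ Pi.π _ j) (Pi.π _ j) (by simp)
  retract := by ext <;> simp [prod.lift_snd_assoc]

/-- The morphism `P ⟶ 1` is a retract of `P × A ⟶ B` if `A` has a global point. -/
noncomputable def retractSndComp {P A B T : C} (hT : IsTerminal T) (x : T ⟶ A) (f : A ⟶ B)
    (p : P ⟶ T) : RetractArrow p ((prod.snd : (P ⨯ A) ⟶ _) ≫ f) where
  i := Arrow.homMk (prod.lift (𝟙 P) (p ≫ x)) (x ≫ f) (by simp [prod.lift_snd_assoc])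
  r := Arrow.homMk prod.fst (hT.from B) (hT.hom_ext _ _)
  retract := by
    ext
    · simp [prod.lift_fst]
    · exact hT.hom_ext _ _

end

namespace NGph

theorem isTerminal_hom {n : ℕ} {Z : NGph.{u} (n + 1)} (hZ : IsTerminal Z) (a b : VGraph.obj Z) :
    Nonempty (IsTerminal (VGraph.hom Z a b)) :=
  VGraph.isTerminal_hom (V := NGph n) hZ a b

theorem trivialFib_prodMap {n : ℕ} {A A' B B' : NGph.{u} n} (f : A ⟶ B) (g : A' ⟶ B')
    (hf : trivialFib n f) (hg : trivialFib n g) : trivialFib n (prod.map f g) := by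
  refine (trivialFib_piMap_iff_of_isLimit (J := WalkingPair)
    (A := fun j => WalkingPair.casesOn j A A') (B := fun j => WalkingPair.casesOn j B B')
    (fun j => WalkingPair.casesOn j f g) (prodIsProd A A') (prodIsProd B B') (prod.map f g)
    ?_).1 (trivialFib_piMap _ ?_)
  · rintro (_ | _)
    · exact prod.map_fst _ _
    · exact prod.map_snd _ _
  · rintro (_ | _)
    · exact hf
    · exact hg

/-- Up to the isomorphism `T ⨯ B ≅ B`, the morphism is the product of `p` and `f`. -/
theorem trivialFib_snd_comp {n : ℕ} {P A B T : NGph.{u} n} (hT : IsTerminal T) (p : P ⟶ T)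
    (f : A ⟶ B) (hp : trivialFib n p) (hf : trivialFib n f) :
    trivialFib n ((prod.snd : P ⨯ A ⟶ A) ≫ f) := by
  have := isIso_prod_snd hT B
  rw [← prod.map_snd p f]
  exact ((trivialFib n).cancel_right_of_respectsIso _ _).2 (trivialFib_prodMap p f hp hf)

end NGph

/-! ### Contractible objects as trivial fibrations over the terminal `n`-graph -/

/-- Contractibility of the objects of a stage is detected by their underlying `n`-graphs, and the
`n`-graph underlying the terminal object has a global point. -/
structure Stage.DetectsContractible {n : ℕ} (S : Stage.{u} n) : Prop where
  isContractible_iff : ∀ (A : S.C) {T : NGph.{u} n} (_ : IsTerminal T) (f : S.U.obj A ⟶ T),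
    S.IsContractible A ↔ NGph.trivialFib n f
  point : Nonempty (⊤_ NGph.{u} n ⟶ S.U.obj (⊤_ S.C))

theorem Stage.detectsContractible_set : Stage.set.{u}.DetectsContractible where
  isContractible_iff A T hT f := by
    rw [NGph.trivialFib_zero_iff_isIso]
    exact ⟨fun ⟨hA⟩ => isIso_of_isTerminal hA hT f,
      fun h => ⟨hT.ofIso (@asIso _ _ _ _ f h).symm⟩⟩
  point := ⟨𝟙 _⟩

/-- A terminal graph has a single object and terminal hom-objects. Surjectivity on objects therefore
says that `A` has an object, and the conditions on hom-objects are those of the previous stage. -/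
theorem Stage.DetectsContractible.enrich {n : ℕ} {S : Stage.{u} n} (hS : S.DetectsContractible)
    (P : NSOperad S.C) : (S.enrich P).DetectsContractible where
  isContractible_iff A T hT f := by
    rw [NGph.trivialFib_succ_iff]
    obtain ⟨t, ht⟩ := VGraph.exists_eq_of_isTerminal (V := NGph n) hT
    have key : ∀ a a', S.IsContractible (VPData.toVGraph A.toVPData |>.hom a a') ↔
        NGph.trivialFib n (VGraph.Hom.hom f a a') := fun a a' =>
      hS.isContractible_iff _ (NGph.isTerminal_hom hT _ _).some _
    exact ⟨fun h => ⟨fun b => ⟨h.nonempty.some, (ht _).trans (ht b).symm⟩,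
        fun a a' => (key a a').1 (h.hom a a')⟩,
      fun h => ⟨(h.1 t).nonempty, fun a a' => (key a a').2 (h.2 a a')⟩⟩
  point := by
    obtain ⟨x⟩ := hS.point
    -- The empty product is a terminal object whose underlying graph is explicit. The point is only
    -- a morphism of graphs, so no compatibility with composition is required.
    let E : VPCat P := VPCat.pi (fun j : PEmpty => j.elim)
    refine ⟨(?_ : ⊤_ NGph (n + 1) ⟶ (S.enrich P).U.obj E) ≫ (S.enrich P).U.map (terminal.from _)⟩
    refine ⟨fun _ j => j.elim, fun a a' => terminal.from _ ≫ x ≫ S.U.map (Pi.lift fun j => j.elim)⟩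

/-! ### Hom-objects of the free constructions as coproducts over strings -/

namespace VGraph

section
variable {V : Type (u + 1)} [Category.{u} V] [HasFiniteProducts V] [HasCoproducts.{u} V]

/-- The strings of objects of `F_* A` and `G_* A` agree. -/
def ObjPath.mapEquiv (F G : V ⥤ V) {A : VGraph V} (a a' : A.obj) :
    ObjPath ((VGraph.map F).obj A) a a' ≃ ObjPath ((VGraph.map G).obj A) a a' where
  toFun σ := ⟨σ.len, σ.pt, σ.source, σ.target⟩
  invFun σ := ⟨σ.len, σ.pt, σ.source, σ.target⟩
  left_inv _ := rfl
  right_inv _ := rfl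

/-- This puts the projection from `Q` to `T` into the form of a coproduct of morphisms. The
isomorphism is needed because strings in `F_* A` and in `G_* A` are formally of different types. -/
theorem fcPToFcHom_comp_fcMap_mapNat {F G : V ⥤ V} (α : F ⟶ G) (P : ℕ → V) (A : VGraph V)
    (a a' : A.obj) :
    fcPToFcHom P ((map F).obj A) a a' ≫ fcMap ((mapNat α).app A) a a' =
      Limits.Sigma.map (f := fun σ : ObjPath ((map F).obj A) a a' =>
          P σ.len ⨯ ((map F).obj A).string σ.pt)
        (g := fun σ : ObjPath ((map F).obj A) a a' =>
          ((map G).obj A).string (ObjPath.mapEquiv F G a a' σ).pt)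
        (fun σ => prod.snd ≫ stringMap ((mapNat α).app A) σ.pt) ≫
      (Sigma.reindex (ObjPath.mapEquiv F G a a') fun σ => ((map G).obj A).string σ.pt).hom := by
  refine Limits.Sigma.hom_ext _ _ fun σ => ?_
  refine (Category.assoc _ _ _).symm.trans ((congrArg (· ≫ _) (ι_fcPToFcHom _ _ _ _ σ)).trans ?_)
  refine (Category.assoc _ _ _).trans ((congrArg _ (ι_fcMap _ _ _ σ)).trans ?_)
  refine (Category.assoc _ _ _).symm.trans ?_
  symm
  refine (Category.assoc _ _ _).symm.trans ((congrArg (· ≫ _) (Limits.Sigma.ι_map _ σ)).trans ?_)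
  refine (Category.assoc _ _ _).trans (congrArg _ ?_)
  exact Sigma.ι_reindex_hom (ObjPath.mapEquiv F G a a')
    (fun σ => ((map G).obj A).string σ.pt) σ

end

end VGraph

/-! ### The inductive comparison of `Q⁽ⁿ⁾` with `T⁽ⁿ⁾` -/

namespace Theory

open NGph

variable (𝒯 : Theory.{u})

theorem detectsContractible (n : ℕ) : (𝒯.V n).DetectsContractible := by
  induction n with
  | zero => rw [𝒯.zero]; exact Stage.detectsContractible_set
  | succ n ih => rw [𝒯.succ]; exact ih.enrich _

theorem isContractibleMap_proj_succ_iff {n : ℕ} (Z : NGph.{u} (n + 1)) :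
    IsContractibleMap ((𝒯.proj (n + 1)).app Z) ↔ ∀ (a a' : VGraph.obj Z)
      (σ : VGraph.ObjPath ((VGraph.map (V := NGph n) (𝒯.Q n)).obj Z) a a'),
      trivialFib n ((prod.snd : (𝒯.UP n σ.len ⨯ _) ⟶ _) ≫
        Limits.Pi.map fun i : Fin σ.len =>
          (𝒯.proj n).app (VGraph.hom Z (σ.pt i.castSucc) (σ.pt i.succ))) := by
  rw [isContractibleMap_succ_iff]
  refine forall_congr' fun a => forall_congr' fun a' => ?_
  refine Iff.trans ?_ (trivialFib_sigmaMap_iff _)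
  refine (iff_of_eq (congrArg (fun f => trivialFib n f) (VGraph.fcPToFcHom_comp_fcMap_mapNat
    (V := NGph n) (𝒯.proj n) (𝒯.UP n) Z a a'))).trans ?_
  exact @MorphismProperty.cancel_right_of_respectsIso _ _ (trivialFib n) _ _ _ _ _ _
    (Iso.isIso_hom _)

/-- Both free functors leave the 0-cells unchanged. Hence contractibility of a component of the
projection already makes it a trivial fibration. -/
theorem mapCell_proj_surjective (n : ℕ) (Z : NGph.{u} n) : Function.Surjective
    (mapCell ((𝒯.proj n).app Z) : Cell n ((𝒯.Q n).obj Z) 0 → Cell n ((strictFree n).obj Z) 0) := by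
  cases n with
  | zero => exact fun z => ⟨z, rfl⟩
  | succ n => exact fun z => ⟨z, rfl⟩

/-- The operad `Pₙ` has a unary operation. -/
theorem nonempty_toUP_one {n : ℕ} (A : NGph.{u} n) : Nonempty (A ⟶ 𝒯.UP n 1) := by
  obtain ⟨x⟩ := (𝒯.detectsContractible n).point
  exact ⟨terminal.from A ≫ x ≫ (𝒯.V n).U.map (𝒯.P n).unit⟩

/-- A cell is sent to a unary composite with itself, recursively, using the unit of the operad. -/
theorem nonempty_toQ {n : ℕ} {Z : NGph.{u} n} (hZ : IsTerminal Z) :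
    Nonempty (Z ⟶ (𝒯.Q n).obj Z) := by
  induction n with
  | zero => exact ⟨𝟙 Z⟩
  | succ n ih =>
    have h := fun a b : VGraph.obj Z => (NGph.isTerminal_hom hZ a b).some
    have x := fun a b : VGraph.obj Z => (ih (h a b)).some
    let ℓ (a b : VGraph.obj Z) : VGraph.ObjPath ((VGraph.map (V := NGph n) (𝒯.Q n)).obj Z) a b :=
      ⟨1, Fin.cons a fun _ => b, rfl, rfl⟩
    -- Passing through terminality of the hom-objects avoids identifying the single factor of the
    -- string with `Z(a, b)`.
    exact ⟨⟨fun a => a, fun a b => prod.lift (𝒯.nonempty_toUP_one _).some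
      (Pi.lift fun _ => (h _ _).from _ ≫ x _ _) ≫ Sigma.ι (fun σ :
        VGraph.ObjPath ((VGraph.map (V := NGph n) (𝒯.Q n)).obj Z) a b => 𝒯.UP n σ.len ⨯
          ((VGraph.map (V := NGph n) (𝒯.Q n)).obj Z).string σ.pt) (ℓ a b)⟩⟩

/-- Stated for an arbitrary terminal object, since the induction passes to hom-objects, which are
terminal but need not be the chosen terminal object. -/
theorem isContractibleMap_proj_iff {n : ℕ} {Z : NGph.{u} n} (hZ : IsTerminal Z) :
    IsContractibleMap ((𝒯.proj n).app Z) ↔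
      ∀ i < n, (𝒯.V i).OperadIsContractible (𝒯.P i) := by
  induction n with
  | zero =>
    refine iff_of_true ⟨fun _ hm => absurd hm (Nat.not_lt_zero _), fun _ _ _ e => e⟩ ?_
    exact fun _ hi => absurd hi (Nat.not_lt_zero _)
  | succ n ih =>
    rw [isContractibleMap_proj_succ_iff, Nat.forall_lt_succ_right]
    have hn := (𝒯.detectsContractible n).isContractible_iff
    constructor
    · intro h
      obtain ⟨z, -⟩ := VGraph.exists_eq_of_isTerminal (V := NGph n) hZ
      obtain ⟨hz⟩ := NGph.isTerminal_hom hZ z z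
      -- The constant string at `z` of each length `k` provides the summand that contains `Pₙ(k)`.
      have h := fun k => h z z ⟨k, fun _ => z, rfl, rfl⟩
      obtain ⟨p⟩ := 𝒯.nonempty_toUP_one ((𝒯.Q n).obj (VGraph.hom Z z z))
      obtain ⟨x⟩ := 𝒯.nonempty_toQ hz
      -- Length 1 isolates the projection in dimension `n`: the unit of the operad supplies the
      -- unary operation.
      have h1 : trivialFib n ((𝒯.proj n).app (VGraph.hom Z z z)) :=
        MorphismProperty.of_retract (retractSndCompPiMap (0 : Fin 1) p _) (h 1)
      refine ⟨(ih hz).1 h1.1, fun k => ?_⟩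
      -- A global point of the power of `Q⁽ⁿ⁾1` isolates the operad factor.
      have hk : trivialFib n (hz.from (𝒯.UP n k)) :=
        MorphismProperty.of_retract (retractSndComp hz (Pi.lift fun _ => x) _ _) (h k)
      exact (hn _ hz (hz.from _)).2 hk
    · rintro ⟨h, hP⟩ a a' σ
      refine trivialFib_snd_comp terminalIsTerminal (terminal.from _) _
        ((hn _ terminalIsTerminal _).1 (hP _)) (trivialFib_piMap _ fun i => ?_)
      exact ⟨(ih (NGph.isTerminal_hom hZ _ _).some).2 h, 𝒯.mapCell_proj_surjective n _⟩

end Theory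

end IterOp

theorem mainTheorem2 (𝒯 : IterOp.Theory.{u}) (n : ℕ) :
    (𝒯.collection n).IsContractible ↔ ∀ i < n, (𝒯.V i).OperadIsContractible (𝒯.P i) :=
  Iff.trans ⟨fun h => ⟨h.lift, h.eq⟩, fun h => ⟨h.lift, h.eq⟩⟩
    (𝒯.isContractibleMap_proj_iff terminalIsTerminal)
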